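/- Let $\rho$ and $\sigma$ be $d\times d$ complex density matrices (positive semidefinite matrices of trace one). For positive semidefinite $d\times d$ matrices $A,B$ let $F(A,B)=\operatorname{Tr}\sqrt{\sqrt{A}\,B\,\sqrt{A}}$ be the quantum fidelity, and for vectors $p,q\in[0,\infty)^d$ let $F(p,q)=\sum_{j=1}^d\sqrt{p_jq_j}$ be the classical fidelity. Let $\lambda^{\downarrow}(A)$ (respectively $\lambda^{\uparrow}(A)$) denote the vector of eigenvalues of $A$, counted with multiplicity, in non-increasing (respectively non-decreasing) order. A mixed unitary channel is a linear map on $d\times d$ complex matrices of the form $\Phi(X)=\sum_{j=1}^k p_jU_jXU_j^{\dagger}$, where $k\ge 1$, $(p_j)$ is a probability distribution and the $U_j$ are $d\times d$ unitary matrices. Then the minimum of $F(\rho,\Phi(\sigma))$ over all mixed unitary channels $\Phi$ exists, and \[\min_{\Phi}F(\rho,\Phi(\sigma))=F(\lambda^{\downarrow}(\rho),\lambda^{\uparrow}(\sigma)).\] -/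

import Mathlib

open scoped MatrixOrder ComplexOrder Matrix

namespace QuantumFidelity

/-- A `d × d` density matrix (quantum state): positive semidefinite with trace one. -/
structure IsDensityMatrix {d : ℕ} (ρ : Matrix (Fin d) (Fin d) ℂ) : Prop where
  posSemidef : ρ.PosSemidef
  trace_eq_one : ρ.trace = 1

/-- The quantum fidelity `F(ρ, σ) = Tr √(√ρ σ √ρ)` of positive semidefinite matrices.
The trace is a non-negative real number there, so taking its real part only changes its type. -/
noncomputable def fidelity {d : ℕ} (ρ σ : Matrix (Fin d) (Fin d) ℂ) : ℝ :=
  (CFC.sqrt (CFC.sqrt ρ * σ * CFC.sqrt ρ)).trace.re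

/-- The classical fidelity `F(p, q) = ∑ⱼ √(pⱼ qⱼ)` of two vectors with non-negative entries. -/
noncomputable def classicalFidelity {d : ℕ} (p q : Fin d → ℝ) : ℝ :=
  ∑ j, Real.sqrt (p j * q j)

/-- `λ↓(A)`: the eigenvalues of a Hermitian matrix with multiplicities, in non-increasing order
(`Matrix.IsHermitian.eigenvalues₀` is antitone). -/
noncomputable def eigenvaluesDown {d : ℕ} {A : Matrix (Fin d) (Fin d) ℂ} (hA : A.IsHermitian) :
    Fin d → ℝ :=
  fun j => hA.eigenvalues₀ (Fin.cast (Fintype.card_fin d).symm j)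

/-- `λ↑(A)`: the eigenvalues of a Hermitian matrix with multiplicities, in non-decreasing order. -/
noncomputable def eigenvaluesUp {d : ℕ} {A : Matrix (Fin d) (Fin d) ℂ} (hA : A.IsHermitian) :
    Fin d → ℝ :=
  fun j => eigenvaluesDown hA j.rev

/-- A mixed unitary channel: `Φ(X) = ∑ⱼ pⱼ Uⱼ X Uⱼ†` for a finite probability distribution `p`
and unitary matrices `Uⱼ`. -/
def IsMixedUnitaryChannel {d : ℕ}
    (Φ : Matrix (Fin d) (Fin d) ℂ →ₗ[ℂ] Matrix (Fin d) (Fin d) ℂ) : Prop :=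
  ∃ (k : ℕ) (p : Fin k → ℝ) (U : Fin k → Matrix (Fin d) (Fin d) ℂ),
    (∀ j, 0 ≤ p j) ∧ ∑ j, p j = 1 ∧ (∀ j, U j ∈ Matrix.unitaryGroup (Fin d) ℂ) ∧
      ∀ X, Φ X = ∑ j, (p j : ℂ) • (U j * X * (U j)ᴴ)

end QuantumFidelity

/-!
Writing `M = √ρ √τ`, the fidelity `F(ρ, τ)` is the trace norm `Tr √(M Mᴴ)` of `M`, hence at least
`Re Tr (√ρ √τ)` (`re_trace_le_re_trace_sqrt_mul_conjTranspose`). For `τ = Φ(σ) = ∑ⱼ pⱼ Uⱼ σ Uⱼᴴ`,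
operator concavity of the square root gives `√τ ≥ ∑ⱼ pⱼ Uⱼ √σ Uⱼᴴ`, and pairing with the positive
matrix `√ρ` preserves this inequality, so it is enough to bound each `Re Tr (√ρ Uⱼ √σ Uⱼᴴ)`.

Expanded in eigenbases of `ρ` and `σ`, this trace is `∑ i j, aᵢ bⱼ |Qᵢⱼ|²` with `Q` unitary and `a`,
`b` the square roots of the eigenvalues. The matrix `|Qᵢⱼ|²` is doubly stochastic, thus a convex
combination of permutation matrices (Birkhoff), and the rearrangement inequality bounds the sum
below by its value when `a` is sorted in non-increasing and `b` in non-decreasing order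
(`sum_mul_le_re_trace_diagonalized`).

Equality is attained by the conjugation with the unitary that carries an eigenbasis of `σ` sorted by
non-decreasing eigenvalue to one of `ρ` sorted by non-increasing eigenvalue: the two matrices
then commute.
-/

namespace QuantumFidelity

open Matrix

/-! ### Positive matrices and their square roots -/

section Matrices

variable {n : Type*} [DecidableEq n]

theorem posSemidef_diagonal_ofReal {a : n → ℝ} (ha : ∀ i, 0 ≤ a i) :
    (diagonal fun i => (a i : ℂ)).PosSemidef :=
  PosSemidef.diagonal fun i => Complex.zero_le_real.2 (ha i)

variable [Fintype n]

theorem conj_mul_conj {V : Matrix n n ℂ} (hV : V ∈ unitaryGroup n ℂ) (A B : Matrix n n ℂ) :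
    V * A * Vᴴ * (V * B * Vᴴ) = V * (A * B) * Vᴴ := by
  have h : Vᴴ * V = 1 := mem_unitaryGroup_iff'.1 hV
  calc V * A * Vᴴ * (V * B * Vᴴ) = V * A * (Vᴴ * V) * B * Vᴴ := by simp only [mul_assoc]
    _ = V * (A * B) * Vᴴ := by simp only [h, mul_assoc, one_mul]

theorem trace_conj {V : Matrix n n ℂ} (hV : V ∈ unitaryGroup n ℂ) (A : Matrix n n ℂ) :
    (V * A * Vᴴ).trace = A.trace := by
  have h : Vᴴ * V = 1 := mem_unitaryGroup_iff'.1 hV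
  rw [trace_mul_comm, ← mul_assoc, h, one_mul]

theorem posSemidef_sqrt (A : Matrix n n ℂ) : (CFC.sqrt A).PosSemidef :=
  (CFC.sqrt_nonneg A).posSemidef

theorem sqrt_conj {V B : Matrix n n ℂ} (hV : V ∈ unitaryGroup n ℂ) (hB : B.PosSemidef) :
    CFC.sqrt (V * B * Vᴴ) = V * CFC.sqrt B * Vᴴ := by
  refine CFC.sqrt_unique ?_ ((posSemidef_sqrt B).mul_mul_conjTranspose_same V).nonneg
  rw [conj_mul_conj hV, CFC.sqrt_mul_sqrt_self B hB.nonneg]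

theorem sqrt_diagonal {a : n → ℝ} (ha : ∀ i, 0 ≤ a i) :
    CFC.sqrt (diagonal fun i => (a i : ℂ)) = diagonal fun i => ((√(a i) : ℝ) : ℂ) := by
  refine CFC.sqrt_unique ?_ (posSemidef_diagonal_ofReal fun i => Real.sqrt_nonneg _).nonneg
  rw [diagonal_mul_diagonal]
  congr 1
  ext i
  rw [← Complex.ofReal_mul, Real.mul_self_sqrt (ha i)]

theorem re_trace_mul_nonneg {A B : Matrix n n ℂ} (hA : A.PosSemidef) (hB : B.PosSemidef) :
    0 ≤ (A * B).trace.re := by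
  have h : (A * B).trace = (CFC.sqrt A * B * (CFC.sqrt A)ᴴ).trace := by
    rw [(posSemidef_sqrt A).isHermitian.eq, trace_mul_comm (_ * _), ← mul_assoc,
      CFC.sqrt_mul_sqrt_self A hA.nonneg]
  rw [h]
  exact (Complex.nonneg_iff.1 (hB.mul_mul_conjTranspose_same _).trace_nonneg).1

open scoped Matrix.Norms.L2Operator in
/-- The square root on matrices is operator concave. The C⋆-norm needed for the general result on
C⋆-algebras does not appear in the statement. -/
theorem sum_smul_sqrt_le_sqrt_sum_smul {ι : Type*} [Fintype ι] {p : ι → ℝ} (hp : ∀ j, 0 ≤ p j)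
    (hp1 : ∑ j, p j = 1) {B : ι → Matrix n n ℂ} (hB : ∀ j, (B j).PosSemidef) :
    ∑ j, p j • CFC.sqrt (B j) ≤ CFC.sqrt (∑ j, p j • B j) :=
  (CFC.concaveOn_sqrt (A := Matrix n n ℂ)).le_map_sum (fun j _ => hp j) hp1
    fun j _ => (hB j).nonneg

/-- A Hermitian matrix is diagonalized by a unitary matrix, with its eigenvalues listed along the
diagonal in any prescribed order, given by the permutation `e`. -/
theorem exists_unitary_eq_conj_diagonal {A : Matrix n n ℂ} (hA : A.IsHermitian) (e : Equiv.Perm n) :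
    ∃ V ∈ unitaryGroup n ℂ, A = V * diagonal (fun i => (hA.eigenvalues (e i) : ℂ)) * Vᴴ := by
  set V : Matrix n n ℂ := (hA.eigenvectorUnitary : Matrix n n ℂ)
  have hVu : V ∈ unitaryGroup n ℂ := hA.eigenvectorUnitary.2
  -- Permuting the columns of the eigenvector matrix permutes the eigenvalues.
  refine ⟨V.submatrix id e, ?_, ?_⟩
  · rw [mem_unitaryGroup_iff', star_eq_conjTranspose, conjTranspose_submatrix,
      ← submatrix_mul _ _ e id e Function.bijective_id, ← star_eq_conjTranspose,
      mem_unitaryGroup_iff'.1 hVu]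
    exact submatrix_one_equiv e
  · have hD : diagonal (fun i => (hA.eigenvalues (e i) : ℂ)) =
        (diagonal fun i => (hA.eigenvalues i : ℂ)).submatrix e e :=
      (submatrix_diagonal_equiv (fun i => (hA.eigenvalues i : ℂ)) e).symm
    rw [hD, conjTranspose_submatrix, submatrix_mul_equiv, submatrix_mul_equiv, submatrix_id_id]
    exact hA.spectral_theorem

/-- The real part of the trace is bounded by the trace norm. In an eigenbasis of `√(M Mᴴ)`, the
`i`-th diagonal entry of `M` is bounded by the Euclidean norm of the `i`-th row of `M`, which is the
`i`-th eigenvalue of `√(M Mᴴ)`. -/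
theorem re_trace_le_re_trace_sqrt_mul_conjTranspose (M : Matrix n n ℂ) :
    M.trace.re ≤ (CFC.sqrt (M * Mᴴ)).trace.re := by
  have hP := posSemidef_sqrt (M * Mᴴ)
  have hsq := CFC.sqrt_mul_sqrt_self (M * Mᴴ) (posSemidef_self_mul_conjTranspose M).nonneg
  obtain ⟨V, hV, hPV⟩ := exists_unitary_eq_conj_diagonal hP.isHermitian (Equiv.refl n)
  simp only [Equiv.refl_apply] at hPV
  set l := hP.isHermitian.eigenvalues
  have hl : ∀ i, 0 ≤ l i := hP.eigenvalues_nonneg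
  have hV1 : Vᴴ * V = 1 := mem_unitaryGroup_iff'.1 hV
  have hV2 : V * Vᴴ = 1 := mem_unitaryGroup_iff.1 hV
  set N := Vᴴ * M * V with hN
  have hM : M = V * N * Vᴴ := by
    calc M = (V * Vᴴ) * M * (V * Vᴴ) := by rw [hV2, one_mul, mul_one]
      _ = V * N * Vᴴ := by simp only [hN, mul_assoc]
  have hNN : N * Nᴴ = diagonal fun i => ((l i * l i : ℝ) : ℂ) := by
    calc N * Nᴴ = Vᴴ * (M * (V * Vᴴ) * Mᴴ) * V := by
          simp only [hN, conjTranspose_mul, conjTranspose_conjTranspose, mul_assoc]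
      _ = Vᴴ * (V * diagonal (fun i => (l i : ℂ)) * Vᴴ * (V * diagonal (fun i => (l i : ℂ)) * Vᴴ))
            * V := by rw [hV2, mul_one, ← hsq, ← hPV]
      _ = (Vᴴ * V) * (diagonal (fun i => (l i : ℂ)) * diagonal (fun i => (l i : ℂ))) * (Vᴴ * V) := by
          rw [conj_mul_conj hV]; simp only [mul_assoc]
      _ = _ := by
          rw [hV1, one_mul, mul_one, diagonal_mul_diagonal]
          simp only [Complex.ofReal_mul]
  rw [hPV, trace_conj hV, hM, trace_conj hV, trace_diagonal, trace, Complex.re_sum, Complex.re_sum]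
  refine Finset.sum_le_sum fun i _ => ?_
  rw [diag_apply, Complex.ofReal_re]
  refine (Complex.re_le_norm _).trans (abs_le_of_sq_le_sq' ?_ (hl i)).2
  have hrow : ∑ j, ‖N i j‖ ^ 2 = l i * l i := by
    have h := congrFun (congrFun hNN i) i
    rw [mul_apply, diagonal_apply_eq] at h
    simp only [conjTranspose_apply, RCLike.star_def, Complex.mul_conj'] at h
    exact_mod_cast h
  calc ‖N i i‖ ^ 2 ≤ ∑ j, ‖N i j‖ ^ 2 :=
        Finset.single_le_sum (f := fun j => ‖N i j‖ ^ 2) (fun j _ => sq_nonneg _) (Finset.mem_univ i)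
    _ = l i ^ 2 := by rw [hrow, sq]

/-! ### Doubly stochastic matrices and rearrangement -/

theorem norm_sq_mem_doublyStochastic {Q : Matrix n n ℂ} (hQ : Q ∈ unitaryGroup n ℂ) :
    (of fun i j => ‖Q i j‖ ^ 2) ∈ doublyStochastic ℝ n := by
  refine mem_doublyStochastic_iff_sum.2 ⟨fun i j => sq_nonneg _, fun i => ?_, fun j => ?_⟩
  · have h := congrFun (congrFun (mem_unitaryGroup_iff.1 hQ) i) i
    rw [mul_apply, one_apply_eq] at h
    simp only [star_apply, RCLike.star_def, Complex.mul_conj'] at h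
    exact_mod_cast h
  · have h := congrFun (congrFun (mem_unitaryGroup_iff'.1 hQ) j) j
    rw [mul_apply, one_apply_eq] at h
    simp only [star_apply, RCLike.star_def, Complex.conj_mul'] at h
    exact_mod_cast h

/-- The rearrangement inequality for doubly stochastic matrices in place of permutations. -/
theorem sum_mul_le_sum_mul_doublyStochastic {S : Matrix n n ℝ} (hS : S ∈ doublyStochastic ℝ n)
    {a b : n → ℝ} (hab : Antivary a b) :
    ∑ i, a i * b i ≤ ∑ i, ∑ j, a i * b j * S i j := by
  obtain ⟨w, hw, hw1, rfl⟩ := exists_eq_sum_perm_of_mem_doublyStochastic hS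
  have key : ∑ i, ∑ j, a i * b j * (∑ π, w π • π.permMatrix ℝ) i j =
      ∑ π, w π * ∑ i, a i * b (π i) := by
    simp only [Matrix.sum_apply, Matrix.smul_apply, smul_eq_mul, Finset.mul_sum]
    rw [Finset.sum_congr rfl fun i _ => Finset.sum_comm, Finset.sum_comm]
    refine Finset.sum_congr rfl fun π _ => Finset.sum_congr rfl fun i _ => ?_
    rw [Finset.sum_eq_single (π i)]
    · simp [Equiv.Perm.permMatrix, PEquiv.toMatrix_apply]
      ring
    · intro j _ hj
      simp [Equiv.Perm.permMatrix, PEquiv.toMatrix_apply, hj.symm]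
    · simp
  rw [key]
  calc ∑ i, a i * b i = ∑ π, w π * ∑ i, a i * b i := by rw [← Finset.sum_mul, hw1, one_mul]
    _ ≤ _ := Finset.sum_le_sum fun π _ =>
      mul_le_mul_of_nonneg_left hab.sum_mul_le_sum_mul_comp_perm (hw π)

/-- Among all pairs of Hermitian matrices with given eigenvalues `a` and `b`, the trace of the
product is least when they are simultaneously diagonal with `a` and `b` oppositely ordered. -/
theorem sum_mul_le_re_trace_diagonalized {V W : Matrix n n ℂ} (hV : V ∈ unitaryGroup n ℂ)
    (hW : W ∈ unitaryGroup n ℂ) {a b : n → ℝ} (hab : Antivary a b) :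
    ∑ i, a i * b i ≤ (V * diagonal (fun i => (a i : ℂ)) * Vᴴ *
      (W * diagonal (fun i => (b i : ℂ)) * Wᴴ)).trace.re := by
  set Q := Vᴴ * W with hQ
  have hQu : Q ∈ unitaryGroup n ℂ := mul_mem (Unitary.star_mem hV) hW
  have h1 : (V * diagonal (fun i => (a i : ℂ)) * Vᴴ *
      (W * diagonal (fun i => (b i : ℂ)) * Wᴴ)).trace =
      (diagonal (fun i => (a i : ℂ)) * (Q * diagonal (fun i => (b i : ℂ)) * Qᴴ)).trace := by
    rw [mul_assoc V, mul_assoc V, trace_mul_comm]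
    simp only [hQ, conjTranspose_mul, conjTranspose_conjTranspose, mul_assoc]
  have h2 : (diagonal (fun i => (a i : ℂ)) * (Q * diagonal (fun i => (b i : ℂ)) * Qᴴ)).trace =
      ((∑ i, ∑ j, a i * b j * ‖Q i j‖ ^ 2 : ℝ) : ℂ) := by
    rw [trace]
    push_cast
    refine Finset.sum_congr rfl fun i _ => ?_
    rw [diag_apply, diagonal_mul, mul_apply, Finset.mul_sum]
    refine Finset.sum_congr rfl fun j _ => ?_
    rw [mul_diagonal, conjTranspose_apply, RCLike.star_def, ← Complex.mul_conj']
    ring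
  rw [h1, h2, Complex.ofReal_re]
  exact sum_mul_le_sum_mul_doublyStochastic (norm_sq_mem_doublyStochastic hQu) hab

end Matrices

/-! ### Sorted eigenvalues -/

variable {d : ℕ}

theorem eigenvaluesDown_antitone {A : Matrix (Fin d) (Fin d) ℂ} (hA : A.IsHermitian) :
    Antitone (eigenvaluesDown hA) := fun _ _ hij =>
  hA.eigenvalues₀_antitone hij

theorem eigenvaluesUp_monotone {A : Matrix (Fin d) (Fin d) ℂ} (hA : A.IsHermitian) :
    Monotone (eigenvaluesUp hA) := fun _ _ hij =>
  eigenvaluesDown_antitone hA (Fin.rev_le_rev.2 hij)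

theorem exists_perm_eigenvaluesDown {A : Matrix (Fin d) (Fin d) ℂ} (hA : A.IsHermitian) :
    ∃ e : Equiv.Perm (Fin d), ∀ i, eigenvaluesDown hA i = hA.eigenvalues (e i) :=
  ⟨(finCongr (Fintype.card_fin d).symm).trans (Fintype.equivOfCardEq (Fintype.card_fin _)),
    fun i => by simp [eigenvaluesDown, IsHermitian.eigenvalues]⟩

theorem eigenvaluesDown_nonneg {A : Matrix (Fin d) (Fin d) ℂ} (hA : A.PosSemidef) (i : Fin d) :
    0 ≤ eigenvaluesDown hA.isHermitian i := by
  obtain ⟨e, he⟩ := exists_perm_eigenvaluesDown hA.isHermitian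
  exact he i ▸ hA.eigenvalues_nonneg _

theorem eigenvaluesUp_nonneg {A : Matrix (Fin d) (Fin d) ℂ} (hA : A.PosSemidef) (i : Fin d) :
    0 ≤ eigenvaluesUp hA.isHermitian i :=
  eigenvaluesDown_nonneg hA _

theorem exists_unitary_eigenvaluesDown {A : Matrix (Fin d) (Fin d) ℂ} (hA : A.IsHermitian) :
    ∃ V ∈ unitaryGroup (Fin d) ℂ, A = V * diagonal (fun i => (eigenvaluesDown hA i : ℂ)) * Vᴴ := by
  obtain ⟨e, he⟩ := exists_perm_eigenvaluesDown hA
  simpa only [he] using exists_unitary_eq_conj_diagonal hA e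

theorem exists_unitary_eigenvaluesUp {A : Matrix (Fin d) (Fin d) ℂ} (hA : A.IsHermitian) :
    ∃ V ∈ unitaryGroup (Fin d) ℂ, A = V * diagonal (fun i => (eigenvaluesUp hA i : ℂ)) * Vᴴ := by
  obtain ⟨e, he⟩ := exists_perm_eigenvaluesDown hA
  simpa only [eigenvaluesUp, he, Equiv.trans_apply, Fin.revPerm_apply] using
    exists_unitary_eq_conj_diagonal hA (Fin.revPerm.trans e)

theorem antivary_sqrt_eigenvalues {A B : Matrix (Fin d) (Fin d) ℂ} (hA : A.IsHermitian)
    (hB : B.IsHermitian) :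
    Antivary (fun i => √(eigenvaluesDown hA i)) (fun i => √(eigenvaluesUp hB i)) :=
  Antitone.antivary (fun _ _ h => Real.sqrt_le_sqrt (eigenvaluesDown_antitone hA h))
    fun _ _ h => Real.sqrt_le_sqrt (eigenvaluesUp_monotone hB h)

/-! ### Bounds on the fidelity -/

/-- The fidelity is the trace norm of `√ρ √τ`, so it dominates the real part of its trace. -/
theorem re_trace_sqrt_mul_sqrt_le_fidelity (ρ : Matrix (Fin d) (Fin d) ℂ)
    {τ : Matrix (Fin d) (Fin d) ℂ} (hτ : τ.PosSemidef) :
    (CFC.sqrt ρ * CFC.sqrt τ).trace.re ≤ fidelity ρ τ := by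
  have h : CFC.sqrt ρ * τ * CFC.sqrt ρ =
      (CFC.sqrt ρ * CFC.sqrt τ) * (CFC.sqrt ρ * CFC.sqrt τ)ᴴ := by
    rw [conjTranspose_mul, (posSemidef_sqrt ρ).isHermitian.eq, (posSemidef_sqrt τ).isHermitian.eq]
    conv_lhs => rw [← CFC.sqrt_mul_sqrt_self τ hτ.nonneg]
    simp only [mul_assoc]
  rw [fidelity, h]
  exact re_trace_le_re_trace_sqrt_mul_conjTranspose _

theorem classicalFidelity_le_re_trace_sqrt_mul_conj {ρ σ U : Matrix (Fin d) (Fin d) ℂ}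
    (hρ : ρ.PosSemidef) (hσ : σ.PosSemidef) (hU : U ∈ unitaryGroup (Fin d) ℂ) :
    classicalFidelity (eigenvaluesDown hρ.isHermitian) (eigenvaluesUp hσ.isHermitian) ≤
      (CFC.sqrt ρ * (U * CFC.sqrt σ * Uᴴ)).trace.re := by
  obtain ⟨V, hV, hρV⟩ := exists_unitary_eigenvaluesDown hρ.isHermitian
  obtain ⟨W, hW, hσW⟩ := exists_unitary_eigenvaluesUp hσ.isHermitian
  have ha := eigenvaluesDown_nonneg hρ
  have hb := eigenvaluesUp_nonneg hσ
  have hab := antivary_sqrt_eigenvalues hρ.isHermitian hσ.isHermitian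
  simp only [classicalFidelity, Real.sqrt_mul (ha _)]
  generalize eigenvaluesDown hρ.isHermitian = a at *
  generalize eigenvaluesUp hσ.isHermitian = b at *
  rw [hρV, hσW, sqrt_conj hV (posSemidef_diagonal_ofReal ha),
    sqrt_conj hW (posSemidef_diagonal_ofReal hb), sqrt_diagonal ha, sqrt_diagonal hb]
  have h := sum_mul_le_re_trace_diagonalized hV (mul_mem hU hW) hab
  simpa only [conjTranspose_mul, mul_assoc] using h

theorem classicalFidelity_le_fidelity_mixedUnitary {ρ σ : Matrix (Fin d) (Fin d) ℂ}
    (hρ : ρ.PosSemidef) (hσ : σ.PosSemidef)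
    {Φ : Matrix (Fin d) (Fin d) ℂ →ₗ[ℂ] Matrix (Fin d) (Fin d) ℂ} (hΦ : IsMixedUnitaryChannel Φ) :
    classicalFidelity (eigenvaluesDown hρ.isHermitian) (eigenvaluesUp hσ.isHermitian) ≤
      fidelity ρ (Φ σ) := by
  obtain ⟨k, p, U, hp, hp1, hU, hΦ⟩ := hΦ
  have hB : ∀ j, (U j * σ * (U j)ᴴ).PosSemidef := fun j => hσ.mul_mul_conjTranspose_same _
  have hΦσ : Φ σ = ∑ j, p j • (U j * σ * (U j)ᴴ) := by
    simp only [hΦ, Complex.coe_smul]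
  have hpos : (Φ σ).PosSemidef := by
    rw [hΦσ]
    exact posSemidef_sum _ fun j _ => (hB j).smul (hp j)
  refine le_trans ?_ (re_trace_sqrt_mul_sqrt_le_fidelity ρ hpos)
  have hconc : ∑ j, p j • (U j * CFC.sqrt σ * (U j)ᴴ) ≤ CFC.sqrt (Φ σ) := by
    simpa only [hΦσ, sqrt_conj (hU _) hσ] using sum_smul_sqrt_le_sqrt_sum_smul hp hp1 hB
  -- Pairing with the positive matrix `√ρ` preserves `∑ⱼ pⱼ Uⱼ √σ Uⱼᴴ ≤ √Φ(σ)`.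
  have hpair := re_trace_mul_nonneg (posSemidef_sqrt ρ) (le_iff.1 hconc)
  rw [mul_sub, trace_sub, Complex.sub_re, sub_nonneg] at hpair
  refine le_trans ?_ hpair
  simp only [Finset.mul_sum, trace_sum, Complex.re_sum, mul_smul_comm, trace_smul, Complex.smul_re,
    smul_eq_mul]
  set c := classicalFidelity (eigenvaluesDown hρ.isHermitian) (eigenvaluesUp hσ.isHermitian)
  calc c = ∑ j, p j * c := by rw [← Finset.sum_mul, hp1, one_mul]
    _ ≤ _ := Finset.sum_le_sum fun j _ => mul_le_mul_of_nonneg_left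
      (classicalFidelity_le_re_trace_sqrt_mul_conj hρ hσ (hU j)) (hp j)

/-- The fidelity of simultaneously diagonalized matrices is the classical fidelity of their
eigenvalues. -/
theorem fidelity_diagonalized {V : Matrix (Fin d) (Fin d) ℂ} (hV : V ∈ unitaryGroup (Fin d) ℂ)
    {a b : Fin d → ℝ} (ha : ∀ i, 0 ≤ a i) (hb : ∀ i, 0 ≤ b i) :
    fidelity (V * diagonal (fun i => (a i : ℂ)) * Vᴴ) (V * diagonal (fun i => (b i : ℂ)) * Vᴴ) =
      classicalFidelity a b := by
  have hD : (diagonal (fun i => ((√(a i) : ℝ) : ℂ)) * diagonal (fun i => (b i : ℂ)) *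
      diagonal (fun i => ((√(a i) : ℝ) : ℂ))) = diagonal fun i => ((a i * b i : ℝ) : ℂ) := by
    rw [diagonal_mul_diagonal, diagonal_mul_diagonal]
    congr 1
    ext i
    rw [← Complex.ofReal_mul, ← Complex.ofReal_mul, mul_right_comm, Real.mul_self_sqrt (ha i)]
  have hab : ∀ i, 0 ≤ a i * b i := fun i => mul_nonneg (ha i) (hb i)
  rw [fidelity, sqrt_conj hV (posSemidef_diagonal_ofReal ha), sqrt_diagonal ha, conj_mul_conj hV,
    conj_mul_conj hV, hD, sqrt_conj hV (posSemidef_diagonal_ofReal hab), sqrt_diagonal hab,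
    trace_conj hV, trace_diagonal, Complex.re_sum]
  rfl

theorem exists_mixedUnitary_fidelity_eq {ρ σ : Matrix (Fin d) (Fin d) ℂ}
    (hρ : ρ.PosSemidef) (hσ : σ.PosSemidef) :
    ∃ Φ : Matrix (Fin d) (Fin d) ℂ →ₗ[ℂ] Matrix (Fin d) (Fin d) ℂ, IsMixedUnitaryChannel Φ ∧
      classicalFidelity (eigenvaluesDown hρ.isHermitian) (eigenvaluesUp hσ.isHermitian) =
        fidelity ρ (Φ σ) := by
  obtain ⟨V, hV, hρV⟩ := exists_unitary_eigenvaluesDown hρ.isHermitian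
  obtain ⟨W, hW, hσW⟩ := exists_unitary_eigenvaluesUp hσ.isHermitian
  have ha := eigenvaluesDown_nonneg hρ
  have hb := eigenvaluesUp_nonneg hσ
  have hW1 : Wᴴ * W = 1 := mem_unitaryGroup_iff'.1 hW
  -- Conjugation with `V * Wᴴ`, which takes the eigenbasis `W` of `σ` to the eigenbasis `V` of `ρ`.
  refine ⟨LinearMap.mulLeft ℂ (V * Wᴴ) ∘ₗ LinearMap.mulRight ℂ (V * Wᴴ)ᴴ,
    ⟨1, fun _ => 1, fun _ => V * Wᴴ, by simp, by simp, fun _ => mul_mem hV (Unitary.star_mem hW),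
      fun X => by simp [mul_assoc]⟩, ?_⟩
  generalize eigenvaluesDown hρ.isHermitian = a at *
  generalize eigenvaluesUp hσ.isHermitian = b at *
  have h : (V * Wᴴ) * (σ * (V * Wᴴ)ᴴ) = V * diagonal (fun i => (b i : ℂ)) * Vᴴ := by
    calc (V * Wᴴ) * (σ * (V * Wᴴ)ᴴ)
        = V * (Wᴴ * W) * diagonal (fun i => (b i : ℂ)) * (Wᴴ * W) * Vᴴ := by
          rw [hσW, conjTranspose_mul, conjTranspose_conjTranspose]
          simp only [mul_assoc]
      _ = _ := by rw [hW1, mul_one, mul_one]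
  rw [LinearMap.comp_apply, LinearMap.mulLeft_apply, LinearMap.mulRight_apply, h, hρV,
    fidelity_diagonalized hV ha hb]

end QuantumFidelity

theorem mainTheorem3 {d : ℕ} (ρ σ : Matrix (Fin d) (Fin d) ℂ)
    (hρ : QuantumFidelity.IsDensityMatrix ρ) (hσ : QuantumFidelity.IsDensityMatrix σ) :
    IsLeast
      {x : ℝ | ∃ Φ : Matrix (Fin d) (Fin d) ℂ →ₗ[ℂ] Matrix (Fin d) (Fin d) ℂ,
        QuantumFidelity.IsMixedUnitaryChannel Φ ∧ x = QuantumFidelity.fidelity ρ (Φ σ)}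
      (QuantumFidelity.classicalFidelity
        (QuantumFidelity.eigenvaluesDown hρ.posSemidef.isHermitian)
        (QuantumFidelity.eigenvaluesUp hσ.posSemidef.isHermitian)) := by
  refine ⟨QuantumFidelity.exists_mixedUnitary_fidelity_eq hρ.posSemidef hσ.posSemidef, ?_⟩
  rintro x ⟨Φ, hΦ, rfl⟩
  exact QuantumFidelity.classicalFidelity_le_fidelity_mixedUnitary hρ.posSemidef hσ.posSemidef hΦ
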